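/- Let $N\in\mathbb{N}$, let $A=\mathrm{Mat}_N(\mathbb{C})$ be the unital algebra of complex $N\times N$ matrices, let $\sigma,\tau:A\to A$ be (unital, $\mathbb{C}$-linear) algebra endomorphisms, and let $M$ be an arbitrary $A$-bimodule, that is, a complex vector space with commuting unital $\mathbb{C}$-bilinear left and right actions of $A$. Let $C^0=M$ and, for $n\ge 1$, let $C^n$ be the space of $\mathbb{C}$-linear maps $A^{\otimes n}\to M$. Define $\delta_n:C^n\to C^{n+1}$ by $(\delta_0 m)(a)=m\,\tau(a)-\sigma(a)\,m$ and, for $n\ge1$, $$(\delta_n\omega)(a_1,\dots,a_{n+1})=\sigma(a_1)\,\omega(a_2,\dots,a_{n+1})+\sum_{j=1}^{n}(-1)^j\omega(a_1,\dots,a_ja_{j+1},\dots,a_{n+1})+(-1)^{n+1}\omega(a_1,\dots,a_n)\,\tau(a_{n+1}).$$ This is the Hochschild cochain complex of $A$ with values in the twisted bimodule $M_{(\sigma,\tau)}$, which is $M$ with the actions $a\cdot m=\sigma(a)m$ and $m\cdot a=m\tau(a)$. For $n\ge 1$ let $$H^n_{(\sigma,\tau)}(A,M)=\ker\delta_n/\operatorname{im}\delta_{n-1}$$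 be the $(\sigma,\tau)$-Hochschild cohomology of $A$ with values in $M$. Then $$H^n_{(\sigma,\tau)}(\mathrm{Mat}_N(\mathbb{C}),M)=0\qquad\text{for every } n\ge 1 .$$ In particular, every $(\sigma,\tau)$-derivation of $\mathrm{Mat}_N(\mathbb{C})$ with values in $M$ is inner: if $X:A\to M$ is $\mathbb{C}$-linear and $X(fg)=\sigma(f)X(g)+X(f)\tau(g)$ for all $f,g\in A$, then there is $m_0\in M$ with $X(f)=m_0\tau(f)-\sigma(f)m_0$ for all $f\in A$. -/

import Mathlib

/-- Changing one entry of a tuple and then multiplying two neighbours changes one entry of the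
contracted tuple, linearly in the new value. -/
theorem contractNth_update_exists {R A : Type*} [CommRing R] [Ring A] [Algebra R A] {n : ℕ}
    (j : Fin n) (a : Fin (n + 1) → A) (i : Fin (n + 1)) :
    ∃ (k : Fin n) (L : A →ₗ[R] A), ∀ x : A,
      Fin.contractNth j.castSucc (· * ·) (Function.update a i x) =
        Function.update (Fin.contractNth j.castSucc (· * ·) a) k (L x) := by
  rcases lt_trichotomy (i : ℕ) (j : ℕ) with h | h | h
  · refine ⟨⟨i, by omega⟩, LinearMap.id, fun x => ?_⟩
    ext l
    simp only [Fin.contractNth, Function.update_apply, Fin.ext_iff, Fin.val_castSucc, Fin.val_succ,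
      LinearMap.id_apply]
    split_ifs <;> first | rfl | omega
  · refine ⟨j, LinearMap.mulRight R (a j.succ), fun x => ?_⟩
    ext l
    simp only [Fin.contractNth, Function.update_apply, Fin.ext_iff, Fin.val_castSucc, Fin.val_succ,
      LinearMap.mulRight_apply]
    split_ifs with h1 h2 h3 h4 h5 h6 <;> first | rfl | omega | skip
    all_goals
      obtain rfl : l = j := Fin.ext (by omega)
      rfl
  · rcases Nat.lt_or_ge ((j : ℕ) + 1) i with h' | h'
    · refine ⟨⟨i - 1, by omega⟩, LinearMap.id, fun x => ?_⟩
      ext l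
      simp only [Fin.contractNth, Function.update_apply, Fin.ext_iff, Fin.val_castSucc,
        Fin.val_succ, LinearMap.id_apply]
      split_ifs <;> first | rfl | omega
    · refine ⟨j, LinearMap.mulLeft R (a j.castSucc), fun x => ?_⟩
      ext l
      simp only [Fin.contractNth, Function.update_apply, Fin.ext_iff, Fin.val_castSucc,
        Fin.val_succ, LinearMap.mulLeft_apply]
      split_ifs <;> first | rfl | omega | skip
      all_goals
        obtain rfl : l = j := Fin.ext (by omega)
        rfl

/-- The `n`-cochains `Cⁿ(A, M)`: the `R`-linear maps `A ⊗ ⋯ ⊗ A → M` (`n` factors), given as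
`n`-fold `R`-multilinear maps. For `n = 0`, such a map is an element of `M`, its only value. -/
abbrev HochschildCochain (R A M : Type*) [CommRing R] [Ring A] [Algebra R A]
    [AddCommGroup M] [Module R M] (n : ℕ) :=
  MultilinearMap R (fun _ : Fin n => A) M

section Faces

variable {R A M : Type*} [CommRing R] [Ring A] [Algebra R A]
  [AddCommGroup M] [Module R M] [Module A M] [Module Aᵐᵒᵖ M]
  [IsScalarTower R A M] [IsScalarTower R Aᵐᵒᵖ M]

/-- The cochain `(a₁, …, aₙ₊₁) ↦ a₁ · ω(a₂, …, aₙ₊₁)`. -/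
def hochschildFirstFace {n : ℕ} (ω : HochschildCochain R A M n) :
    HochschildCochain R A M (n + 1) where
  toFun a := a 0 • ω (Fin.tail a)
  map_update_add' {inst} a i x y := by
    obtain rfl : inst = instDecidableEqFin (n + 1) := Subsingleton.elim _ _
    refine Fin.cases (fun x y => ?_) (fun k x y => ?_) i x y
    · have h (z : A) : Fin.tail (Function.update a 0 z) = Fin.tail a := Fin.tail_update_zero ..
      rw [h, h, h, Function.update_self, Function.update_self, Function.update_self, add_smul]
    · have h (z : A) : Fin.tail (Function.update a k.succ z) =
          Function.update (Fin.tail a) k z := Fin.tail_update_succ ..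
      have h' (z : A) : Function.update a k.succ z 0 = a 0 :=
        Function.update_of_ne (Fin.succ_ne_zero k).symm ..
      rw [h, h, h, h', h', h', MultilinearMap.map_update_add, smul_add]
  map_update_smul' {inst} a i c x := by
    obtain rfl : inst = instDecidableEqFin (n + 1) := Subsingleton.elim _ _
    refine Fin.cases (fun x => ?_) (fun k x => ?_) i x
    · have h (z : A) : Fin.tail (Function.update a 0 z) = Fin.tail a := Fin.tail_update_zero ..
      rw [h, h, Function.update_self, Function.update_self, smul_assoc]
    · have h (z : A) : Fin.tail (Function.update a k.succ z) =
          Function.update (Fin.tail a) k z := Fin.tail_update_succ ..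
      have h' (z : A) : Function.update a k.succ z 0 = a 0 :=
        Function.update_of_ne (Fin.succ_ne_zero k).symm ..
      have : SMulCommClass R A M := IsScalarTower.to_smulCommClass
      rw [h, h, h', h', MultilinearMap.map_update_smul, smul_comm c]

/-- The cochain `(a₁, …, aₙ₊₁) ↦ ω(a₁, …, aₙ) · aₙ₊₁`. -/
def hochschildLastFace {n : ℕ} (ω : HochschildCochain R A M n) :
    HochschildCochain R A M (n + 1) where
  toFun a := MulOpposite.op (a (Fin.last n)) • ω (Fin.init a)
  map_update_add' {inst} a i x y := by
    obtain rfl : inst = instDecidableEqFin (n + 1) := Subsingleton.elim _ _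
    refine Fin.lastCases (fun x y => ?_) (fun k x y => ?_) i x y
    · have h (z : A) : Fin.init (Function.update a (Fin.last n) z) = Fin.init a :=
        Fin.init_update_last ..
      rw [h, h, h, Function.update_self, Function.update_self, Function.update_self,
        MulOpposite.op_add, add_smul]
    · have h (z : A) : Fin.init (Function.update a k.castSucc z) =
          Function.update (Fin.init a) k z := Fin.init_update_castSucc ..
      have h' (z : A) : Function.update a k.castSucc z (Fin.last n) = a (Fin.last n) :=
        Function.update_of_ne (Fin.castSucc_lt_last k).ne' ..
      rw [h, h, h, h', h', h', MultilinearMap.map_update_add, smul_add]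
  map_update_smul' {inst} a i c x := by
    obtain rfl : inst = instDecidableEqFin (n + 1) := Subsingleton.elim _ _
    refine Fin.lastCases (fun x => ?_) (fun k x => ?_) i x
    · have h (z : A) : Fin.init (Function.update a (Fin.last n) z) = Fin.init a :=
        Fin.init_update_last ..
      rw [h, h, Function.update_self, Function.update_self, MulOpposite.op_smul, smul_assoc]
    · have h (z : A) : Fin.init (Function.update a k.castSucc z) =
          Function.update (Fin.init a) k z := Fin.init_update_castSucc ..
      have h' (z : A) : Function.update a k.castSucc z (Fin.last n) = a (Fin.last n) :=
        Function.update_of_ne (Fin.castSucc_lt_last k).ne' ..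
      have : SMulCommClass R Aᵐᵒᵖ M := IsScalarTower.to_smulCommClass
      rw [h, h, h', h', MultilinearMap.map_update_smul, smul_comm c]

/-- The cochain `(a₁, …, aₙ₊₁) ↦ ω(a₁, …, aⱼ aⱼ₊₁, …, aₙ₊₁)`, where `j : Fin n` is counted
from `0`. -/
def hochschildMiddleFace {n : ℕ} (j : Fin n) (ω : HochschildCochain R A M n) :
    HochschildCochain R A M (n + 1) where
  toFun a := ω (Fin.contractNth j.castSucc (· * ·) a)
  map_update_add' {inst} a i x y := by
    obtain rfl : inst = instDecidableEqFin (n + 1) := Subsingleton.elim _ _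
    obtain ⟨k, L, h⟩ := contractNth_update_exists (R := R) j a i
    rw [h, h, h, map_add, MultilinearMap.map_update_add]
  map_update_smul' {inst} a i c x := by
    obtain rfl : inst = instDecidableEqFin (n + 1) := Subsingleton.elim _ _
    obtain ⟨k, L, h⟩ := contractNth_update_exists (R := R) j a i
    rw [h, h, map_smul, MultilinearMap.map_update_smul]

end Faces

section Complex

variable (R A M : Type*) [CommRing R] [Ring A] [Algebra R A]
  [AddCommGroup M] [Module R M] [Module A M] [Module Aᵐᵒᵖ M]
  [IsScalarTower R A M] [IsScalarTower R Aᵐᵒᵖ M]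

/-- The alternating sum
`a₁ · ω(a₂, …, aₙ₊₁) + ∑ⱼ (-1)ʲ ω(a₁, …, aⱼ aⱼ₊₁, …, aₙ₊₁) + (-1)ⁿ⁺¹ ω(a₁, …, aₙ) · aₙ₊₁`,
with `j` running from `1` to `n`. -/
def hochschildAlternatingSum (n : ℕ) :
    HochschildCochain R A M n →ₗ[R] HochschildCochain R A M (n + 1) where
  toFun ω := hochschildFirstFace ω
    + ∑ j : Fin n, (-1 : ℤ) ^ ((j : ℕ) + 1) • hochschildMiddleFace j ω
    + (-1 : ℤ) ^ (n + 1) • hochschildLastFace ω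
  map_add' ω ρ := by
    ext a
    simp only [hochschildFirstFace, hochschildMiddleFace, hochschildLastFace,
      add_apply, sum_apply, smul_apply,
      MultilinearMap.coe_mk, smul_add, Finset.sum_add_distrib]
    abel
  map_smul' c ω := by
    have : SMulCommClass R A M := IsScalarTower.to_smulCommClass
    have : SMulCommClass R Aᵐᵒᵖ M := IsScalarTower.to_smulCommClass
    ext a
    simp only [hochschildFirstFace, hochschildMiddleFace, hochschildLastFace,
      add_apply, sum_apply, smul_apply,
      MultilinearMap.coe_mk, smul_add, Finset.smul_sum, RingHom.id_apply, smul_comm c]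

/-- The Hochschild differential `δₙ : Cⁿ(A, M) → Cⁿ⁺¹(A, M)`. In degree `0` the sign convention
is `(δ₀ m)(a) = m · a - a · m`; see `hochschildDifferential_zero_apply` and
`hochschildDifferential_succ_apply` for the formulas. -/
def hochschildDifferential :
    (n : ℕ) → HochschildCochain R A M n →ₗ[R] HochschildCochain R A M (n + 1)
  | 0 => -hochschildAlternatingSum R A M 0
  | n + 1 => hochschildAlternatingSum R A M (n + 1)

variable {R A M} in
theorem hochschildDifferential_zero_apply (m : M) (a : Fin 1 → A) :
    hochschildDifferential R A M 0 (MultilinearMap.constOfIsEmpty R (fun _ : Fin 0 => A) m) a =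
      MulOpposite.op (a 0) • m - a 0 • m := by
  simp [hochschildDifferential, hochschildAlternatingSum, hochschildFirstFace, hochschildLastFace,
    sub_eq_add_neg]

variable {R A M} in
theorem hochschildDifferential_succ_apply {n : ℕ} (ω : HochschildCochain R A M (n + 1))
    (a : Fin (n + 2) → A) :
    hochschildDifferential R A M (n + 1) ω a =
      a 0 • ω (Fin.tail a)
      + ∑ j : Fin (n + 1), (-1 : ℤ) ^ ((j : ℕ) + 1) •
          ω (Fin.contractNth j.castSucc (· * ·) a)
      + (-1 : ℤ) ^ (n + 2) • MulOpposite.op (a (Fin.last (n + 1))) • ω (Fin.init a) := by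
  simp only [hochschildDifferential, hochschildAlternatingSum, hochschildFirstFace,
    hochschildMiddleFace, hochschildLastFace, LinearMap.coe_mk, AddHom.coe_mk,
    add_apply, sum_apply, smul_apply,
    MultilinearMap.coe_mk]

/-- The `n`-cocycles `Zⁿ(A, M)`. -/
def hochschildCocycles (n : ℕ) : Submodule R (HochschildCochain R A M n) :=
  LinearMap.ker (hochschildDifferential R A M n)

/-- The `n`-coboundaries `Bⁿ(A, M)`. -/
def hochschildCoboundaries : (n : ℕ) → Submodule R (HochschildCochain R A M n)
  | 0 => ⊥
  | n + 1 => LinearMap.range (hochschildDifferential R A M n)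

/-- The Hochschild cohomology `Hⁿ(A, M) = Zⁿ(A, M) / Bⁿ(A, M)`. -/
abbrev HochschildCohomology (n : ℕ) :=
  hochschildCocycles R A M n ⧸
    (hochschildCoboundaries R A M n).submoduleOf (hochschildCocycles R A M n)

end Complex

section Twisted

variable {R A : Type*} [CommRing R] [Ring A] [Algebra R A]

/-- The twisted bimodule `M_(σ,τ)`: the `R`-module `M` with the actions
`a · m = σ(a) m` and `m · a = m τ(a)`. -/
def TwistedBimodule (_σ _τ : A →ₐ[R] A) (M : Type*) := M

variable (σ τ : A →ₐ[R] A) (M : Type*) [AddCommGroup M] [Module R M] [Module A M] [Module Aᵐᵒᵖ M]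

set_option linter.unusedSectionVars false

instance : AddCommGroup (TwistedBimodule σ τ M) := inferInstanceAs (AddCommGroup M)

instance : Module R (TwistedBimodule σ τ M) := inferInstanceAs (Module R M)

instance : Module A (TwistedBimodule σ τ M) := Module.compHom M (σ : A →+* A)

instance : Module Aᵐᵒᵖ (TwistedBimodule σ τ M) :=
  Module.compHom M (AlgHom.op τ : Aᵐᵒᵖ →+* Aᵐᵒᵖ)

theorem TwistedBimodule.smul_def (a : A) (m : M) :
    (show M from a • (show TwistedBimodule σ τ M from m)) = σ a • m := rfl

theorem TwistedBimodule.op_smul_def (a : A) (m : M) :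
    (show M from MulOpposite.op a • (show TwistedBimodule σ τ M from m)) =
      MulOpposite.op (τ a) • m := rfl

instance [IsScalarTower R A M] : IsScalarTower R A (TwistedBimodule σ τ M) where
  smul_assoc c a m := by
    change σ (c • a) • (show M from m) = c • (σ a • (show M from m))
    rw [map_smul, smul_assoc]

instance [IsScalarTower R Aᵐᵒᵖ M] : IsScalarTower R Aᵐᵒᵖ (TwistedBimodule σ τ M) where
  smul_assoc c a m := by
    change AlgHom.op τ (c • a) • (show M from m) = c • (AlgHom.op τ a • (show M from m))
    rw [map_smul, smul_assoc]

instance [SMulCommClass A Aᵐᵒᵖ M] : SMulCommClass A Aᵐᵒᵖ (TwistedBimodule σ τ M) where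
  smul_comm a b m := by
    change σ a • (AlgHom.op τ b • (show M from m)) = AlgHom.op τ b • (σ a • (show M from m))
    rw [smul_comm]

/-- The `(σ,τ)`-Hochschild cohomology `Hⁿ_(σ,τ)(A, M) = Hⁿ(A, M_(σ,τ))`. -/
abbrev SigmaTauHochschildCohomology [IsScalarTower R A M] [IsScalarTower R Aᵐᵒᵖ M] (n : ℕ) :=
  HochschildCohomology R A (TwistedBimodule σ τ M) n

variable {M}

/-- `X` is a `(σ,τ)`-derivation with values in `M`: `X(fg) = σ(f) X(g) + X(f) τ(g)`. -/
def IsSigmaTauDerivation (X : A →ₗ[R] M) : Prop :=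
  ∀ f g : A, X (f * g) = σ f • X g + MulOpposite.op (τ g) • X f

/-- `X` is inner: `X(f) = m₀ τ(f) - σ(f) m₀` for some `m₀ ∈ M`. -/
def IsInnerSigmaTau (X : A →ₗ[R] M) : Prop :=
  ∃ m₀ : M, ∀ f : A, X f = MulOpposite.op (τ f) • m₀ - σ f • m₀

end Twisted

/-! Matrix algebras are separable, and separability kills Hochschild cohomology in positive degree
for every bimodule, twisted ones included. A separability element `∑ xᵢ ⊗ yᵢ` yields the contraction
`(sω)(a) = ∑ xᵢ · ω(yᵢ, a)`, and `hochschildContraction_homotopy` gives `sδ + δs = id`, so a cocycle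
`ω` equals `δ(sω)`. The same averaging, applied to a `(σ,τ)`-derivation `X`, produces `∑ σ(xᵢ)
X(yᵢ)`, which up to sign is the element that makes `X` inner. -/

open scoped TensorProduct

/-! ### Separability of matrix algebras -/

/-- The family of simple tensors `x i ⊗ y i` sums to a separability element of `A`: its image under
multiplication is `1`, and it commutes with the outer actions of `A` on `A ⊗ A`. -/
structure IsSeparabilityFamily (R : Type*) {A ι : Type*} [CommRing R] [Ring A] [Algebra R A]
    [Fintype ι] (x y : ι → A) : Prop where
  sum_mul : ∑ i, x i * y i = 1
  sum_mul_tmul : ∀ a : A, ∑ i, (a * x i) ⊗ₜ[R] y i = ∑ i, x i ⊗ₜ[R] (y i * a)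

/-- Matrix algebras have a separability element, namely `∑ i, Eᵢₖ ⊗ Eₖᵢ` for any fixed `k`. -/
theorem Matrix.isSeparabilityFamily_single (R : Type*) {n : Type*} [CommRing R] [Fintype n]
    [DecidableEq n] (k : n) :
    IsSeparabilityFamily R (fun i : n => Matrix.single i k (1 : R))
      (fun i : n => Matrix.single k i (1 : R)) where
  sum_mul := by
    simp only [Matrix.single_mul_single_same, mul_one]
    exact Matrix.sum_single_one
  sum_mul_tmul a := by
    have hl (i : n) : a * Matrix.single i k (1 : R) =
        ∑ j, a j i • Matrix.single j k (1 : R) := by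
      ext p q
      by_cases hq : q = k
      · subst hq
        simp [Matrix.sum_apply, Matrix.single_apply]
      · simp [Matrix.sum_apply, hq, Ne.symm hq]
    have hr (i : n) : Matrix.single k i (1 : R) * a =
        ∑ j, a i j • Matrix.single k j (1 : R) := by
      ext p q
      by_cases hp : p = k
      · subst hp
        simp [Matrix.sum_apply, Matrix.single_apply]
      · simp [Matrix.sum_apply, hp, Ne.symm hp]
    -- With scalars moved across the tensor sign, both sides are the double sum of `a j i • (Eⱼₖ ⊗
    -- Eₖᵢ)`, with the roles of `i` and `j` exchanged.
    simp only [hl, hr, TensorProduct.sum_tmul, TensorProduct.tmul_sum, TensorProduct.smul_tmul]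
    exact Finset.sum_comm

theorem Matrix.exists_isSeparabilityFamily (R n : Type*) [CommRing R] [Fintype n]
    [DecidableEq n] : ∃ x y : n → Matrix n n R, IsSeparabilityFamily R x y := by
  cases isEmpty_or_nonempty n with
  -- With no index `k` to choose, the matrix ring is zero, so `1 = 0` and the empty family works.
  | inl _ => exact ⟨0, 0, ⟨Subsingleton.elim _ _, fun a => by simp⟩⟩
  | inr h => exact h.elim fun k => ⟨_, _, Matrix.isSeparabilityFamily_single R k⟩

/-! ### The contracting homotopy -/

section Homotopy

variable {R A M ι : Type*} [CommRing R] [Ring A] [Algebra R A] [Fintype ι]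
  [AddCommGroup M] [Module R M] [Module A M] [IsScalarTower R A M]

/-- The linear map `u ⊗ v ↦ u • f v` carries the tensor identity into `M`. Only the left action
enters, and `f` need only be `R`-linear. -/
theorem IsSeparabilityFamily.sum_mul_smul {x y : ι → A} (h : IsSeparabilityFamily R x y)
    (f : A →ₗ[R] M) (a : A) : ∑ i, a • x i • f (y i) = ∑ i, x i • f (y i * a) := by
  have := congrArg (TensorProduct.lift ((Algebra.lsmul R R M).toLinearMap.compl₂ f))
    (h.sum_mul_tmul a)
  simpa [mul_smul] using this

/-- The cochain `(a₁, …, aₙ) ↦ ∑ᵢ xᵢ · ω(yᵢ, a₁, …, aₙ)`. -/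
def hochschildContraction (x y : ι → A) {n : ℕ} (ω : HochschildCochain R A M (n + 1)) :
    HochschildCochain R A M n :=
  ∑ i, (Algebra.lsmul R R M (x i)).compMultilinearMap (ω.curryLeft (y i))

theorem hochschildContraction_apply (x y : ι → A) {n : ℕ} (ω : HochschildCochain R A M (n + 1))
    (a : Fin n → A) :
    hochschildContraction x y ω a = ∑ i, x i • ω (Fin.cons (y i) a) := by
  simp [hochschildContraction]

theorem contractNth_zero_cons {n : ℕ} (b : A) (a : Fin (n + 1) → A) :
    Fin.contractNth (Fin.castSucc (0 : Fin (n + 1))) (· * ·) (Fin.cons b a : Fin (n + 2) → A) =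
      Fin.cons (b * a 0) (Fin.tail a) := by
  ext l
  refine Fin.cases ?_ (fun l => ?_) l
  · simp [Fin.contractNth]
  · simp [Fin.contractNth, Fin.tail]

theorem contractNth_succ_cons {n : ℕ} (j : Fin n) (b : A) (a : Fin (n + 1) → A) :
    Fin.contractNth (Fin.castSucc j.succ) (· * ·) (Fin.cons b a : Fin (n + 2) → A) =
      Fin.cons b (Fin.contractNth j.castSucc (· * ·) a) := by
  ext l
  refine Fin.cases ?_ (fun l => ?_) l
  · simp [Fin.contractNth]
  · simp [Fin.contractNth]

variable [Module Aᵐᵒᵖ M] [IsScalarTower R Aᵐᵒᵖ M]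

theorem hochschildAlternatingSum_apply {n : ℕ} (ω : HochschildCochain R A M n)
    (a : Fin (n + 1) → A) :
    hochschildAlternatingSum R A M n ω a =
      a 0 • ω (Fin.tail a)
      + ∑ j : Fin n, (-1 : ℤ) ^ ((j : ℕ) + 1) • ω (Fin.contractNth j.castSucc (· * ·) a)
      + (-1 : ℤ) ^ (n + 1) • MulOpposite.op (a (Fin.last n)) • ω (Fin.init a) := by
  simp only [hochschildAlternatingSum, hochschildFirstFace, hochschildMiddleFace,
    hochschildLastFace, LinearMap.coe_mk, AddHom.coe_mk, add_apply, sum_apply, smul_apply,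
    MultilinearMap.coe_mk]

/-- Prepending `b` moves the inner products and the last face of `a` up one place, which reverses
their signs; this is why they cancel in the homotopy. The first face of `a` is replaced by the two
terms `b • ω a` and the one containing `b * a 0`. -/
theorem hochschildAlternatingSum_cons {n : ℕ} (ω : HochschildCochain R A M (n + 1)) (b : A)
    (a : Fin (n + 1) → A) :
    hochschildAlternatingSum R A M (n + 1) ω (Fin.cons b a) =
      b • ω a - ω (Fin.cons (b * a 0) (Fin.tail a))
      - ∑ j : Fin n, (-1 : ℤ) ^ ((j : ℕ) + 1) •
          ω (Fin.cons b (Fin.contractNth j.castSucc (· * ·) a))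
      - (-1 : ℤ) ^ (n + 1) • MulOpposite.op (a (Fin.last n)) • ω (Fin.cons b (Fin.init a)) := by
  have hinit : Fin.init (Fin.cons b a : Fin (n + 2) → A) = Fin.cons b (Fin.init a) :=
    funext fun l => Fin.cases rfl (fun _ => rfl) l
  have hlast : (Fin.cons b a : Fin (n + 2) → A) (Fin.last (n + 1)) = a (Fin.last n) := rfl
  rw [hochschildAlternatingSum_apply, Fin.sum_univ_succ, contractNth_zero_cons, hinit, hlast]
  simp only [contractNth_succ_cons, Fin.cons_zero, Fin.tail_cons, Fin.val_zero, Fin.val_succ,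
    pow_succ _ (n + 1), pow_succ _ (_ + 1), mul_neg, mul_one, neg_smul, Finset.sum_neg_distrib,
    zero_add, pow_one, one_smul]
  abel

/-- Contracting with a separability element is a homotopy from the identity to zero. -/
theorem hochschildContraction_homotopy [SMulCommClass A Aᵐᵒᵖ M] {x y : ι → A}
    (h : IsSeparabilityFamily R x y) {n : ℕ} (ω : HochschildCochain R A M (n + 1)) :
    hochschildContraction x y (hochschildAlternatingSum R A M (n + 1) ω) +
      hochschildAlternatingSum R A M n (hochschildContraction x y ω) = ω := by
  ext a
  have hone : ∑ i, x i • y i • ω a = ω a := by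
    simp only [← mul_smul, ← Finset.sum_smul, h.sum_mul, one_smul]
  -- The one cancellation not due to signs: the first face of the contracted cochain against the
  -- terms containing `yᵢ * a 0`.
  have hbal : ∑ i, a 0 • x i • ω (Fin.cons (y i) (Fin.tail a)) =
      ∑ i, x i • ω (Fin.cons (y i * a 0) (Fin.tail a)) := by
    refine h.sum_mul_smul
      (LinearMap.mk ⟨fun b => ω (Fin.cons b (Fin.tail a)), fun b c => ?_⟩ fun c b => ?_) (a 0)
    · exact ω.cons_add _ b c
    · exact ω.cons_smul _ c b
  rw [add_apply, hochschildContraction_apply, hochschildAlternatingSum_apply]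
  simp only [hochschildContraction_apply, hochschildAlternatingSum_cons, smul_sub,
    Finset.sum_sub_distrib, hone, Finset.smul_sum, hbal]
  rw [Finset.sum_comm (s := (Finset.univ : Finset (Fin n)))]
  -- For the last faces to match, `xᵢ` must pass the right action, so the two actions have to
  -- commute.
  simp only [smul_comm (x _) ((-1 : ℤ) ^ _), smul_comm (x _) (MulOpposite.op _)]
  abel

/-- A cocycle of positive degree is a coboundary when `A` has a separability element. -/
theorem IsSeparabilityFamily.subsingleton_hochschildCohomology [SMulCommClass A Aᵐᵒᵖ M]
    {x y : ι → A} (h : IsSeparabilityFamily R x y) (n : ℕ) :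
    Subsingleton (HochschildCohomology R A M (n + 1)) := by
  refine Submodule.Quotient.subsingleton_iff.mpr (Submodule.comap_subtype_eq_top.mpr ?_)
  intro ω hω
  have hω' : hochschildAlternatingSum R A M (n + 1) ω = 0 := hω
  have key := hochschildContraction_homotopy h ω
  have hzero : hochschildContraction x y (0 : HochschildCochain R A M (n + 2)) = 0 := by
    ext a
    simp [hochschildContraction_apply]
  rw [hω', hzero, zero_add] at key
  -- Degree one is separate because `δ₀` is minus the alternating sum, so the primitive changes
  -- sign.
  cases n with
  | zero =>
    refine ⟨-hochschildContraction x y ω, ?_⟩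
    rw [hochschildDifferential, LinearMap.neg_apply, map_neg, neg_neg, key]
  | succ n => exact ⟨hochschildContraction x y ω, key⟩

end Homotopy

/-! ### Twisted derivations -/

section Derivation

variable {R A M ι : Type*} [CommRing R] [Ring A] [Algebra R A] [Fintype ι]
  [AddCommGroup M] [Module R M] [Module A M] [Module Aᵐᵒᵖ M] [IsScalarTower R A M]
  [SMulCommClass A Aᵐᵒᵖ M]

/-- A twisted derivation is inner when `A` has a separability element. -/
theorem IsSeparabilityFamily.isInnerSigmaTau {x y : ι → A} (h : IsSeparabilityFamily R x y)
    {σ τ : A →ₐ[R] A} {X : A →ₗ[R] M} (hX : IsSigmaTauDerivation σ τ X) :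
    IsInnerSigmaTau σ τ X := by
  refine ⟨-∑ i, σ (x i) • X (y i), fun f => ?_⟩
  have hbal : ∑ i, σ f • σ (x i) • X (y i) = ∑ i, σ (x i) • X (y i * f) :=
    -- Viewing `X` as valued in the twisted bimodule turns the left action into multiplication
    -- through `σ`. Expanding `X(yᵢ f)` by the Leibniz rule then isolates `X f`.
    h.sum_mul_smul (show A →ₗ[R] TwistedBimodule σ τ M from X) f
  have hone : ∑ i, σ (x i) • σ (y i) • X f = X f := by
    simp only [← mul_smul, ← map_mul, ← Finset.sum_smul, ← map_sum, h.sum_mul, map_one, one_smul]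
  simp only [hX _ f, smul_add, Finset.sum_add_distrib, hone] at hbal
  simp only [smul_neg, Finset.smul_sum, hbal, smul_comm (σ _) (MulOpposite.op (τ f))]
  abel

end Derivation

theorem mainTheorem5 (N : ℕ)
    (σ τ : Matrix (Fin N) (Fin N) ℂ →ₐ[ℂ] Matrix (Fin N) (Fin N) ℂ)
    (M : Type*) [AddCommGroup M] [Module ℂ M]
    [Module (Matrix (Fin N) (Fin N) ℂ) M] [Module (Matrix (Fin N) (Fin N) ℂ)ᵐᵒᵖ M]
    [IsScalarTower ℂ (Matrix (Fin N) (Fin N) ℂ) M]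
    [IsScalarTower ℂ (Matrix (Fin N) (Fin N) ℂ)ᵐᵒᵖ M]
    [SMulCommClass (Matrix (Fin N) (Fin N) ℂ) (Matrix (Fin N) (Fin N) ℂ)ᵐᵒᵖ M] :
    (∀ n : ℕ, 1 ≤ n → Subsingleton (SigmaTauHochschildCohomology σ τ M n)) ∧
    (∀ X : Matrix (Fin N) (Fin N) ℂ →ₗ[ℂ] M,
      IsSigmaTauDerivation σ τ X → IsInnerSigmaTau σ τ X) := by
  obtain ⟨x, y, h⟩ := Matrix.exists_isSeparabilityFamily ℂ (Fin N)
  refine ⟨fun n hn => ?_, fun X hX => h.isInnerSigmaTau hX⟩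
  obtain ⟨n, rfl⟩ := Nat.exists_eq_add_of_le' hn
  -- The coefficients there are an arbitrary bimodule, here `M_(σ,τ)`.
  exact h.subsingleton_hochschildCohomology n
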